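/- **Setting.** An $\mathbb R$-tree is a metric space in which any two points $a,b$ are joined by an isometric copy of $[0,d(a,b)]$ that is the range of every injective path from $a$ to $b$. Let $\mathbb T$ be the set of compact rooted $\mathbb R$-trees $(T,d,\rho)$ up to root-preserving isometry, with the Borel $\sigma$-algebra of the pointed Gromov–Hausdorff distance, and let ${\rm ht}(T)=\sup_{x\in T}d(\rho,x)$. A string is $\xi=([0,\ell],(x_i)_{i\ge1},(p_i)_{i\ge1})$ with $\ell\ge0$, $x_i\in[0,\ell]$ (not necessarily distinct) and $p_i\ge0$ (not necessarily summable); the space $\Xi$ of strings carries the product $\sigma$-algebra. Fix $\beta\in(0,\infty)$. For $\xi\in\Xi$ and $\tau_i\in\mathbb T$, $i\ge1$, let $\phi_\beta(\xi,(\tau_i)_{i\ge1})\in\mathbb T$ be the tree obtained from $[0,\ell]$, rooted at $0$, by attaching for each $i$ the tree $\tau_i$, with all distances multiplied by $p_i^\beta$, by its root at the point $x_i$; if the result is not compact, let $\phi_\beta(\xi,(\tau_i)_{i\ge1})$ be the one-point tree. Let $\xi=([0,L],(X_i)_{i\ge1},(P_i)_{i\ge1})$ be a random string. For a probability measure $\eta$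 on $\mathbb T$, let $\Phi_\beta(\eta)$ be the distribution of $\phi_\beta(\xi,(\tau_i)_{i\ge1})$, where $\tau_1,\tau_2,\dots$ are i.i.d. with distribution $\eta$ and independent of $\xi$. For $p\ge1$ let $\mathcal P_p$ be the set of probability measures on $\mathbb T$ under which ${\rm ht}$ has a finite $p$-th moment. Call $p\ge1$ *admissible* if $\mathbb E[L^p]<\infty$ and $\mathbb E\big[\sum_{i\ge1}P_i^{p\beta}\big]<1$, and let $p^*=\sup\{p\ge1:\ p\text{ admissible}\}\in[1,\infty]$. **Corollary (Moments).** Let $p_0\ge1$ be admissible, and let $\eta^*$ be the fixpoint of $\Phi_\beta$ in $\mathcal P_{p_0}$, i.e. $\eta^*\in\mathcal P_{p_0}$ and $\Phi_\beta(\eta^*)=\eta^*$. Then $\eta^*\in\mathcal P_p$ for every admissible $p\ge1$, and a random tree $\check{\mathcal T}\sim\eta^*$ satisfies $$\mathbb E\big[{\rm ht}(\check{\mathcal T})^p\big]<\infty\qquad\text{for all real }p\text{ with }0\le p<p^*.$$ -/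

import Mathlib

open MeasureTheory ProbabilityTheory
open scoped ENNReal

namespace CRT

/-- A metric space is an `ℝ`-tree if any two points `a`, `b` are joined by an isometric copy
`h` of `[0, d(a,b)]`, and every injective path from `a` to `b` has the same range as `h`. -/
def IsRTree (T : Type) [MetricSpace T] : Prop :=
  ∀ a b : T, ∃ h : ℝ → T,
    (∀ s ∈ Set.Icc 0 (dist a b), ∀ t ∈ Set.Icc 0 (dist a b), dist (h s) (h t) = |s - t|) ∧
    h 0 = a ∧ h (dist a b) = b ∧
    ∀ q : Path a b, Function.Injective q → Set.range q = h '' Set.Icc 0 (dist a b)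

/-- A compact rooted `ℝ`-tree. -/
structure RootedTree : Type 1 where
  carrier : Type
  [metric : MetricSpace carrier]
  [compact : CompactSpace carrier]
  root : carrier
  isRTree : IsRTree carrier

attribute [instance] RootedTree.metric RootedTree.compact

/-- Two compact rooted `ℝ`-trees are equivalent if there is an isometry from one onto the other
which maps root to root. -/
instance RootedTree.setoid : Setoid RootedTree where
  r S T := ∃ e : S.carrier ≃ᵢ T.carrier, e S.root = T.root
  iseqv :=
    { refl := fun S => ⟨IsometryEquiv.refl S.carrier, rfl⟩
      symm := fun {_ _} ⟨e, he⟩ => ⟨e.symm, by rw [← he, IsometryEquiv.symm_apply_apply]⟩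
      trans := fun {_ _ _} ⟨e, he⟩ ⟨f, hf⟩ => ⟨e.trans f, by
        rw [IsometryEquiv.trans_apply, he, hf]⟩ }

/-- The space `𝕋` of equivalence classes of compact rooted `ℝ`-trees. -/
def TreeSpace : Type 1 := Quotient RootedTree.setoid

/-- The equivalence class of a compact rooted tree. -/
def TreeSpace.mk (T : RootedTree) : TreeSpace := Quotient.mk RootedTree.setoid T

/-- A representative of an equivalence class. -/
noncomputable def TreeSpace.out (τ : TreeSpace) : RootedTree := Quotient.out τ

/-- The height `sup_x d(ρ, x)` of a compact rooted tree. -/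
noncomputable def RootedTree.ht (T : RootedTree) : ℝ := ⨆ x : T.carrier, dist T.root x

/-- The height of an equivalence class. -/
noncomputable def TreeSpace.ht (τ : TreeSpace) : ℝ :=
  Quotient.lift RootedTree.ht (by
    rintro S T ⟨e, he⟩
    refine e.toEquiv.iSup_congr fun x => ?_
    change dist T.root (e x) = dist S.root x
    rw [← he, e.dist_eq]) τ

/-- All values `max (δ(φ ρ, φ' ρ')) (δ_H (φ S, φ' T))` for isometric embeddings `φ`, `φ'` of two
rooted trees into a common metric space. -/
def RootedTree.ghValues (S T : RootedTree) : Set ℝ :=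
  {r | ∃ (M : Type) (_ : MetricSpace M) (f : S.carrier → M) (g : T.carrier → M),
    Isometry f ∧ Isometry g ∧
    r = max (dist (f S.root) (g T.root)) (Metric.hausdorffDist (Set.range f) (Set.range g))}

theorem RootedTree.ghValues_subset {S S' T T' : RootedTree} (hS : S ≈ S') (hT : T ≈ T') :
    S.ghValues T ⊆ S'.ghValues T' := by
  obtain ⟨e, he⟩ := hS
  obtain ⟨e', he'⟩ := hT
  rintro r ⟨M, hM, f, g, hf, hg, rfl⟩
  refine ⟨M, hM, f ∘ e.symm, g ∘ e'.symm, hf.comp e.symm.isometry, hg.comp e'.symm.isometry, ?_⟩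
  simp only [Function.comp_apply, ← he, ← he', IsometryEquiv.symm_apply_apply]
  rw [e.symm.surjective.range_comp f, e'.symm.surjective.range_comp g]

/-- The (pointed) Gromov-Hausdorff distance on `𝕋`. -/
noncomputable def TreeSpace.dGH (σ τ : TreeSpace) : ℝ :=
  Quotient.lift₂ (fun S T : RootedTree => sInf (S.ghValues T))
    (fun _ _ _ _ h h' => congrArg sInf (Set.Subset.antisymm
      (RootedTree.ghValues_subset h h')
      (RootedTree.ghValues_subset (Setoid.symm h) (Setoid.symm h')))) σ τ

/-- The topology of the Gromov-Hausdorff distance. -/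
instance : TopologicalSpace TreeSpace where
  IsOpen U := ∀ τ ∈ U, ∃ ε > 0, ∀ σ, TreeSpace.dGH τ σ < ε → σ ∈ U
  isOpen_univ := fun _ _ => ⟨1, one_pos, fun _ _ => trivial⟩
  isOpen_inter := fun U V hU hV τ hτ => by
    obtain ⟨a, ha, h⟩ := hU τ hτ.1
    obtain ⟨b, hb, h'⟩ := hV τ hτ.2
    exact ⟨min a b, lt_min ha hb, fun σ hσ =>
      ⟨h σ (hσ.trans_le (min_le_left _ _)), h' σ (hσ.trans_le (min_le_right _ _))⟩⟩
  isOpen_sUnion := fun A hA τ hτ => by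
    obtain ⟨U, hU, hτU⟩ := hτ
    obtain ⟨a, ha, h⟩ := hA U hU τ hτU
    exact ⟨a, ha, fun σ hσ => ⟨U, hU, h σ hσ⟩⟩

instance : MeasurableSpace TreeSpace := borel TreeSpace

instance : BorelSpace TreeSpace := ⟨rfl⟩

/-- The one-point tree. -/
def pointTree : RootedTree where
  carrier := PUnit
  root := PUnit.unit
  isRTree := fun a b => ⟨fun _ => a, by
    refine ⟨fun s hs t ht => ?_, rfl, rfl, fun q _ => ?_⟩
    · rw [Subsingleton.elim a b, dist_self, Set.Icc_self] at hs ht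
      rw [Set.mem_singleton_iff.1 hs, Set.mem_singleton_iff.1 ht]
      simp
    · rw [(Set.range_nonempty q).eq_univ,
        ((Set.nonempty_Icc.2 (dist_nonneg (x := a) (y := b))).image _).eq_univ]⟩

/-- Strings `([0,ℓ], (x_i), (p_i))`: a length `ℓ ≥ 0`, locations `x_i ∈ [0,ℓ]`, not necessarily
distinct, and masses `p_i ≥ 0`, not necessarily summable. They carry the product
`σ`-algebra. -/
abbrev BeadString : Type :=
  {ξ : ℝ × (ℕ → ℝ) × (ℕ → ℝ) //
    0 ≤ ξ.1 ∧ (∀ i, ξ.2.1 i ∈ Set.Icc 0 ξ.1) ∧ ∀ i, 0 ≤ ξ.2.2 i}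

namespace BeadString

/-- The length `ℓ`. -/
def len (ξ : BeadString) : ℝ := ξ.1.1

/-- The locations `x_i`. -/
def loc (ξ : BeadString) (i : ℕ) : ℝ := ξ.1.2.1 i

/-- The masses `p_i`. -/
def mass (ξ : BeadString) (i : ℕ) : ℝ := ξ.1.2.2 i

end BeadString

/-- Points of the disjoint union of the string `[0,ℓ]` and of the trees `t i`. The roots are kept:
the root of `t i` is at distance `0` from the point `x_i` of the string. -/
abbrev GluePoint (ξ : BeadString) (t : ℕ → RootedTree) : Type :=
  Set.Icc (0 : ℝ) ξ.len ⊕ (Σ i, (t i).carrier)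

open Classical in
/-- The distance on the disjoint union in which `t i`, with all distances multiplied by
`p_i ^ β`, is attached by its root to the point `x_i` of the string. -/
noncomputable def glueDist (β : ℝ) (ξ : BeadString) (t : ℕ → RootedTree) :
    GluePoint ξ t → GluePoint ξ t → ℝ
  | Sum.inl x, Sum.inl y => |(x : ℝ) - y|
  | Sum.inl x, Sum.inr ⟨j, y⟩ =>
      |(x : ℝ) - ξ.loc j| + ξ.mass j ^ β * dist (t j).root y
  | Sum.inr ⟨i, x⟩, Sum.inl y =>
      |(y : ℝ) - ξ.loc i| + ξ.mass i ^ β * dist (t i).root x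
  | Sum.inr ⟨i, x⟩, Sum.inr ⟨j, y⟩ =>
      if h : i = j then ξ.mass j ^ β * dist (cast (by rw [h]) x) y
      else ξ.mass i ^ β * dist (t i).root x + |ξ.loc i - ξ.loc j|
        + ξ.mass j ^ β * dist (t j).root y

/-- `T` is, up to isometry, the disjoint union with the distance `glueDist`, points at distance
`0` being identified, rooted at the point `0` of the string. -/
def IsGlued (β : ℝ) (ξ : BeadString) (t : ℕ → RootedTree) (T : RootedTree) : Prop :=
  ∃ F : GluePoint ξ t → T.carrier,
    Function.Surjective F ∧
    (∀ a b, dist (F a) (F b) = glueDist β ξ t a b) ∧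
    F (Sum.inl ⟨0, Set.left_mem_Icc.2 ξ.2.1⟩) = T.root

open Classical in
/-- The map `φ_β : Ξ × 𝕋^ℕ → 𝕋`: attach the rescaled trees `p_i ^ β τ_i` to the points `x_i` of the
string. The outcome is the one-point tree if the resulting space is not compact. -/
noncomputable def phi (β : ℝ) (ϑ : BeadString × (ℕ → TreeSpace)) : TreeSpace :=
  if h : ∃ T : RootedTree, IsGlued β ϑ.1 (fun i => (ϑ.2 i).out) T then
    TreeSpace.mk h.choose
  else TreeSpace.mk pointTree

/-- The map `Φ_β`: the law of `φ_β (ξ, τ_i, i ≥ 1)`, where `ξ` has law `ν`, the trees `τ_i` are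
independent with law `η`, and `ξ` is independent of `(τ_i)`. -/
noncomputable def Phi (β : ℝ) (ν : Measure BeadString) (η : Measure TreeSpace) :
    Measure TreeSpace :=
  Measure.map (phi β) (ν.prod (Measure.infinitePi fun _ : ℕ => η))

/-- The `p`-th moment of the tree height under `η`, with values in `[0,∞]`. -/
noncomputable def heightMoment (p : ℝ) (η : Measure TreeSpace) : ℝ≥0∞ :=
  ∫⁻ τ, ENNReal.ofReal (τ.ht ^ p) ∂η

/-- The set `𝒫_p` of laws on `𝕋` under which the height has a finite `p`-th moment. -/
def Pspace (p : ℝ) : Set (Measure TreeSpace) :=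
  {η | IsProbabilityMeasure η ∧ heightMoment p η < ∞}

/-- `p ≥ 1`, `E[L^p] < ∞` and `E[∑ P_i^(pβ)] < 1` for a random string with law `ν`. -/
def Admissible (β : ℝ) (ν : Measure BeadString) (p : ℝ) : Prop :=
  1 ≤ p ∧ ∫⁻ ξ, ENNReal.ofReal (ξ.len ^ p) ∂ν < ∞ ∧
    ∫⁻ ξ, ∑' i, ENNReal.ofReal (ξ.mass i ^ (p * β)) ∂ν < 1

/-- `p* = sup {p ≥ 1 : E[∑ P_i^(pβ)] < 1 and E[L^p] < ∞}`, possibly `∞`. -/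
noncomputable def pStar (β : ℝ) (ν : Measure BeadString) : EReal :=
  sSup ((fun p : ℝ => (p : EReal)) '' {p | Admissible β ν p})

end CRT

namespace CRT

/-! The height of a glued tree is at most `L` plus one rescaled height `P_i ^ β * ht τ_i`. For a
fixpoint with finite `q`-th moment and `q ≤ p`, the elementary bound for powers of sums suggests `M
≤ C + D * c p * M` for the `p`-th moment `M`, with `c s = E[∑ P_i ^ (s * β)]` and `D` close to 1.
This is void while `M` may be infinite, so `h ^ p` is replaced by a truncation growing like `h ^ q`
beyond `K`. Rescaling by `a` turns the level `K` into `K / a`, possibly larger, so all levels are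
treated at once: a bound `A + B * K ^ (p - q)` for every `K` reproduces itself with the same `A` and
with `D * c q * B` for `B`. Admissibility of `q` sends `B` to 0, and Fatou's lemma removes the
truncation (`heightMoment_lt_top_of_fixed`). -/

/-! ### Continuity of the height. -/

theorem RootedTree.bddAbove_dist_root (T : RootedTree) :
    BddAbove (Set.range fun x : T.carrier => dist T.root x) :=
  (isCompact_range (by fun_prop)).bddAbove

theorem RootedTree.dist_root_le_ht (T : RootedTree) (x : T.carrier) : dist T.root x ≤ T.ht :=
  le_ciSup T.bddAbove_dist_root x

theorem RootedTree.ht_nonneg (T : RootedTree) : 0 ≤ T.ht :=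
  Real.iSup_nonneg fun _ => dist_nonneg

theorem RootedTree.exists_dist_root_eq_ht (T : RootedTree) :
    ∃ x : T.carrier, dist T.root x = T.ht := by
  have : Nonempty T.carrier := ⟨T.root⟩
  obtain ⟨x, -, hx⟩ := isCompact_univ.exists_isMaxOn (Set.univ_nonempty (α := T.carrier))
    (f := fun x => dist T.root x) (by fun_prop)
  exact ⟨x, le_antisymm (T.dist_root_le_ht x) (ciSup_le fun y => hx (Set.mem_univ y))⟩

@[simp]
theorem TreeSpace.ht_mk (T : RootedTree) : (TreeSpace.mk T).ht = T.ht := rfl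

theorem TreeSpace.ht_out (τ : TreeSpace) : τ.out.ht = τ.ht := by
  conv_rhs => rw [← Quotient.out_eq τ]
  rfl

theorem TreeSpace.ht_nonneg (τ : TreeSpace) : 0 ≤ τ.ht := by
  rw [← τ.ht_out]; exact τ.out.ht_nonneg

theorem RootedTree.ghValues_nonempty (S T : RootedTree) : (S.ghValues T).Nonempty :=
  ⟨_, _, inferInstance, kuratowskiEmbedding S.carrier, kuratowskiEmbedding T.carrier,
    kuratowskiEmbedding.isometry _, kuratowskiEmbedding.isometry _, rfl⟩

/-- A highest point and the root each have a partner within `ε`, which costs `2 * ε`. -/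
theorem RootedTree.ht_lt_of_ghValues {S T : RootedTree} {r ε : ℝ} (hr : r ∈ S.ghValues T)
    (hε : r < ε) : S.ht < T.ht + 2 * ε ∧ T.ht < S.ht + 2 * ε := by
  obtain ⟨M, _, f, g, hf, hg, rfl⟩ := hr
  have : Nonempty S.carrier := ⟨S.root⟩
  have : Nonempty T.carrier := ⟨T.root⟩
  obtain ⟨h1, h2⟩ := max_lt_iff.1 hε
  -- Excludes the default value 0 that `hausdorffDist` takes at infinite distance.
  have hfin : Metric.hausdorffEDist (Set.range f) (Set.range g) ≠ ⊤ :=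
    Metric.hausdorffEDist_ne_top_of_nonempty_of_bounded (Set.range_nonempty f)
      (Set.range_nonempty g) (isCompact_range hf.continuous).isBounded
      (isCompact_range hg.continuous).isBounded
  constructor
  · obtain ⟨x, hx⟩ := S.exists_dist_root_eq_ht
    obtain ⟨-, ⟨y, rfl⟩, hy⟩ :=
      Metric.exists_dist_lt_of_hausdorffDist_lt (Set.mem_range_self x) h2 hfin
    have := dist_triangle4 (f S.root) (g T.root) (g y) (f x)
    rw [hf.dist_eq, hg.dist_eq, dist_comm (g y)] at this
    linarith [T.dist_root_le_ht y]
  · obtain ⟨x, hx⟩ := T.exists_dist_root_eq_ht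
    obtain ⟨-, ⟨y, rfl⟩, hy⟩ :=
      Metric.exists_dist_lt_of_hausdorffDist_lt' (Set.mem_range_self x) h2 hfin
    have := dist_triangle4 (g T.root) (f S.root) (f y) (g x)
    rw [hf.dist_eq, hg.dist_eq, dist_comm (g T.root)] at this
    linarith [S.dist_root_le_ht y]

theorem TreeSpace.ht_lt_of_dGH {σ τ : TreeSpace} {ε : ℝ} (h : dGH σ τ < ε) :
    σ.ht < τ.ht + 2 * ε ∧ τ.ht < σ.ht + 2 * ε := by
  induction σ, τ using Quotient.inductionOn₂ with
  | h S T =>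
    obtain ⟨r, hr, hrε⟩ := exists_lt_of_csInf_lt (S.ghValues_nonempty T) h
    exact RootedTree.ht_lt_of_ghValues hr hrε

theorem TreeSpace.continuous_ht : Continuous TreeSpace.ht := by
  rw [OrderTopology.continuous_iff]
  refine fun a => ⟨fun τ hτ => ⟨(τ.ht - a) / 2, by simpa using hτ, fun σ hσ => ?_⟩,
    fun τ hτ => ⟨(a - τ.ht) / 2, by simpa using hτ, fun σ hσ => ?_⟩⟩
  · have := (ht_lt_of_dGH hσ).1
    simp only [Set.mem_preimage, Set.mem_Ioi]; linarith
  · have := (ht_lt_of_dGH hσ).2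
    simp only [Set.mem_preimage, Set.mem_Iio]; linarith

@[fun_prop]
theorem TreeSpace.measurable_ht : Measurable TreeSpace.ht :=
  TreeSpace.continuous_ht.measurable

/-! ### Height of a glued tree. -/

namespace BeadString

theorem len_nonneg (ξ : BeadString) : 0 ≤ ξ.len := ξ.2.1

theorem loc_mem (ξ : BeadString) (i : ℕ) : ξ.loc i ∈ Set.Icc 0 ξ.len := ξ.2.2.1 i

theorem mass_nonneg (ξ : BeadString) (i : ℕ) : 0 ≤ ξ.mass i := ξ.2.2.2 i

@[fun_prop]
theorem measurable_len : Measurable len := measurable_fst.comp measurable_subtype_coe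

@[fun_prop]
theorem measurable_mass (i : ℕ) : Measurable fun ξ : BeadString => ξ.mass i :=
  (measurable_pi_apply i).comp
    (measurable_snd.comp (measurable_snd.comp measurable_subtype_coe))

end BeadString

theorem IsGlued.ht_le {β : ℝ} {ξ : BeadString} {t : ℕ → RootedTree} {T : RootedTree}
    (h : IsGlued β ξ t T) :
    T.ht ≤ ξ.len ∨ ∃ i, T.ht ≤ ξ.len + ξ.mass i ^ β * (t i).ht := by
  obtain ⟨F, hF, hd, h0⟩ := h
  obtain ⟨x, hx⟩ := T.exists_dist_root_eq_ht
  obtain ⟨a, rfl⟩ := hF x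
  rw [← hx, ← h0, hd]
  rcases a with a | ⟨i, y⟩
  · left
    have := a.2
    simp only [glueDist, zero_sub, abs_neg]
    rw [abs_of_nonneg this.1]
    exact this.2
  · refine Or.inr ⟨i, ?_⟩
    have := ξ.loc_mem i
    simp only [glueDist, zero_sub, abs_neg]
    rw [abs_of_nonneg this.1]
    exact add_le_add this.2 (mul_le_mul_of_nonneg_left ((t i).dist_root_le_ht y)
      (Real.rpow_nonneg (ξ.mass_nonneg i) _))

theorem pointTree_ht : pointTree.ht = 0 := by
  obtain ⟨x, hx⟩ := pointTree.exists_dist_root_eq_ht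
  rw [← hx]
  exact dist_self _

/-- The height of the glued tree is at most the length of the string plus the height of one of
the rescaled trees. -/
theorem ht_phi_le (β : ℝ) (ϑ : BeadString × (ℕ → TreeSpace)) :
    (phi β ϑ).ht ≤ ϑ.1.len ∨ ∃ i, (phi β ϑ).ht ≤ ϑ.1.len + ϑ.1.mass i ^ β * (ϑ.2 i).ht := by
  unfold phi
  split_ifs with h
  · simpa only [TreeSpace.ht_out, TreeSpace.ht_mk] using h.choose_spec.ht_le
  · left
    rw [TreeSpace.ht_mk, pointTree_ht]
    exact ϑ.1.len_nonneg

/-! ### Truncated powers. -/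

/-- The power `h ^ p`, truncated so as to grow like `h ^ q` beyond `K`. -/
noncomputable def truncPow (q p K h : ℝ) : ℝ := h ^ q * min h K ^ (p - q)

section truncPow

variable {q p K : ℝ}

theorem truncPow_nonneg (hK : 0 ≤ K) {h : ℝ} (hh : 0 ≤ h) : 0 ≤ truncPow q p K h := by
  have := le_min hh hK
  unfold truncPow; positivity

theorem truncPow_mono (hq : 0 ≤ q) (hqp : q ≤ p) (hK : 0 ≤ K) {h k : ℝ} (hh : 0 ≤ h)
    (hhk : h ≤ k) : truncPow q p K h ≤ truncPow q p K k := by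
  have := le_min hh hK
  have h2 : 0 ≤ p - q := sub_nonneg.2 hqp
  have h3 : 0 ≤ k := hh.trans hhk
  unfold truncPow; gcongr

theorem truncPow_of_le (hp : p ≠ 0) {h : ℝ} (hh : 0 ≤ h) (hhK : h ≤ K) :
    truncPow q p K h = h ^ p := by
  rw [truncPow, min_eq_left hhK, ← Real.rpow_add' hh (by simpa using hp)]
  congr 1; ring

theorem truncPow_le_rpow (hp : p ≠ 0) (hqp : q ≤ p) (hK : 0 ≤ K) {h : ℝ} (hh : 0 ≤ h) :
    truncPow q p K h ≤ h ^ p := by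
  rw [← truncPow_of_le (q := q) hp hh le_rfl, truncPow, truncPow, min_self]
  have := le_min hh hK
  have h2 : 0 ≤ p - q := sub_nonneg.2 hqp
  gcongr
  exact min_le_left _ _

theorem truncPow_le_mul_rpow (hqp : q ≤ p) (hK : 0 ≤ K) {h : ℝ} (hh : 0 ≤ h) :
    truncPow q p K h ≤ h ^ q * K ^ (p - q) := by
  have := le_min hh hK
  have h2 : 0 ≤ p - q := sub_nonneg.2 hqp
  unfold truncPow
  gcongr
  exact min_le_right _ _

theorem truncPow_mul {a : ℝ} (ha : 0 < a) (hK : 0 ≤ K) {h : ℝ} (hh : 0 ≤ h) :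
    truncPow q p K (a * h) = a ^ p * truncPow q p (K / a) h := by
  have h1 : min (a * h) K = a * min h (K / a) := by
    rw [mul_min_of_nonneg _ _ ha.le, mul_div_cancel₀ _ ha.ne']
  rw [truncPow, truncPow, h1, Real.mul_rpow ha.le hh,
    Real.mul_rpow ha.le (le_min hh (by positivity)), show a ^ p = a ^ q * a ^ (p - q) by
      rw [← Real.rpow_add ha]; congr 1; ring]
  ring

theorem truncPow_mul_le (hqp : q ≤ p) {a : ℝ} (ha : 1 ≤ a) (hK : 0 ≤ K) {h : ℝ}
    (hh : 0 ≤ h) : truncPow q p K (a * h) ≤ a ^ p * truncPow q p K h := by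
  have ha0 : 0 < a := by linarith
  rw [truncPow_mul ha0 hK hh, truncPow, truncPow]
  have := le_min hh (div_nonneg hK ha0.le)
  have h2 : 0 ≤ p - q := sub_nonneg.2 hqp
  gcongr
  exact div_le_self hK ha

/-- Either `x ≤ δ * y` or `y ≤ δ⁻¹ * x`, so the sum is a multiple of one term at most. The factor of
`y` can be brought near 1 at the expense of that of `x`. -/
theorem truncPow_add_le (hq : 0 ≤ q) (hqp : q ≤ p) (hK : 0 ≤ K) {δ : ℝ} (hδ : 0 < δ) {x y : ℝ}
    (hx : 0 ≤ x) (hy : 0 ≤ y) :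
    truncPow q p K (x + y) ≤
      (1 + δ⁻¹) ^ p * truncPow q p K x + (1 + δ) ^ p * truncPow q p K y := by
  have hδ' : 0 < δ⁻¹ := inv_pos.2 hδ
  have h1 := truncPow_nonneg (q := q) (p := p) hK hx
  have h2 := truncPow_nonneg (q := q) (p := p) hK hy
  rcases le_total x (δ * y) with h | h
  · calc truncPow q p K (x + y) ≤ truncPow q p K ((1 + δ) * y) :=
          truncPow_mono hq hqp hK (by positivity) (by linarith)
      _ ≤ (1 + δ) ^ p * truncPow q p K y := truncPow_mul_le hqp (by linarith) hK hy
      _ ≤ _ := le_add_of_nonneg_left (by positivity)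
  · have h' : y ≤ δ⁻¹ * x := by rwa [inv_mul_eq_div, le_div_iff₀' hδ]
    calc truncPow q p K (x + y) ≤ truncPow q p K ((1 + δ⁻¹) * x) :=
          truncPow_mono hq hqp hK (by positivity) (by linarith)
      _ ≤ (1 + δ⁻¹) ^ p * truncPow q p K x := truncPow_mul_le hqp (by linarith) hK hx
      _ ≤ _ := le_add_of_nonneg_right (by positivity)

@[fun_prop]
theorem measurable_truncPow : Measurable (truncPow q p K) := by
  unfold truncPow; fun_prop

end truncPow

/-! ### The fixpoint inequality for truncated moments. -/

theorem ofReal_truncPow_ht_phi_le {β q p K δ : ℝ} (hq : 0 < q) (hqp : q ≤ p) (hK : 0 ≤ K)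
    (hδ : 0 < δ) (ϑ : BeadString × (ℕ → TreeSpace)) :
    ENNReal.ofReal (truncPow q p K (phi β ϑ).ht) ≤
      ENNReal.ofReal ((1 + δ⁻¹) ^ p) * ENNReal.ofReal (ϑ.1.len ^ p) +
      ENNReal.ofReal ((1 + δ) ^ p) *
        ∑' i, ENNReal.ofReal (truncPow q p K (ϑ.1.mass i ^ β * (ϑ.2 i).ht)) := by
  have hL := ϑ.1.len_nonneg
  have hδ' : 0 < δ⁻¹ := inv_pos.2 hδ
  have hp : p ≠ 0 := (hq.trans_le hqp).ne'
  have key : ∀ y, 0 ≤ y → (phi β ϑ).ht ≤ ϑ.1.len + y →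
      ENNReal.ofReal (truncPow q p K (phi β ϑ).ht) ≤
        ENNReal.ofReal ((1 + δ⁻¹) ^ p) * ENNReal.ofReal (ϑ.1.len ^ p) +
        ENNReal.ofReal ((1 + δ) ^ p) * ENNReal.ofReal (truncPow q p K y) := by
    intro y hy h
    have h2 := truncPow_nonneg (q := q) (p := p) hK hy
    rw [← ENNReal.ofReal_mul (by positivity), ← ENNReal.ofReal_mul (by positivity),
      ← ENNReal.ofReal_add (by positivity) (by positivity)]
    refine ENNReal.ofReal_le_ofReal ?_
    refine (truncPow_mono hq.le hqp hK (TreeSpace.ht_nonneg _) h).trans ?_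
    refine (truncPow_add_le hq.le hqp hK hδ hL hy).trans ?_
    gcongr
    exact truncPow_le_rpow hp hqp hK hL
  rcases ht_phi_le β ϑ with h | ⟨i, h⟩
  · refine (key 0 le_rfl (by simpa using h)).trans ?_
    rw [truncPow, Real.zero_rpow hq.ne', zero_mul, ENNReal.ofReal_zero]
    gcongr
    exact zero_le
  · refine (key _ (mul_nonneg (Real.rpow_nonneg (ϑ.1.mass_nonneg i) _)
      (TreeSpace.ht_nonneg _)) h).trans ?_
    gcongr
    exact ENNReal.le_tsum i

/-- The truncated moment of the height. -/
noncomputable def truncMoment (q p K : ℝ) (η : Measure TreeSpace) : ℝ≥0∞ :=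
  ∫⁻ τ, ENNReal.ofReal (truncPow q p K τ.ht) ∂η

/-- Otherwise `Measure.map` returns the zero measure, which is not a probability measure. Thus the
fixpoint equation itself supplies the measurability of `phi`. -/
theorem aemeasurable_phi_of_fixed {β : ℝ} {ν : Measure BeadString} {η : Measure TreeSpace}
    [IsProbabilityMeasure η] (hfix : Phi β ν η = η) :
    AEMeasurable (phi β) (ν.prod (Measure.infinitePi fun _ : ℕ => η)) := by
  by_contra h
  rw [Phi, Measure.map_of_not_aemeasurable h] at hfix
  exact IsProbabilityMeasure.ne_zero η hfix.symm

theorem truncMoment_le_of_fixed {β q p K δ : ℝ} {ν : Measure BeadString}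
    [IsProbabilityMeasure ν] {η : Measure TreeSpace} [IsProbabilityMeasure η]
    (hfix : Phi β ν η = η) (hq : 0 < q) (hqp : q ≤ p) (hK : 0 ≤ K) (hδ : 0 < δ) :
    truncMoment q p K η ≤
      ENNReal.ofReal ((1 + δ⁻¹) ^ p) * ∫⁻ ξ, ENNReal.ofReal (ξ.len ^ p) ∂ν +
      ENNReal.ofReal ((1 + δ) ^ p) *
        ∫⁻ ξ, ∑' i, ∫⁻ τ, ENNReal.ofReal (truncPow q p K (ξ.mass i ^ β * τ.ht)) ∂η ∂ν := by
  have hm : ∀ i, Measurable fun ϑ : BeadString × (ℕ → TreeSpace) =>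
      ENNReal.ofReal (truncPow q p K (ϑ.1.mass i ^ β * (ϑ.2 i).ht)) := fun i => by fun_prop
  have hsum : Measurable fun ϑ : BeadString × (ℕ → TreeSpace) =>
      ∑' i, ENNReal.ofReal (truncPow q p K (ϑ.1.mass i ^ β * (ϑ.2 i).ht)) :=
    Measurable.tsum hm
  calc truncMoment q p K η = truncMoment q p K (Phi β ν η) := by rw [hfix]
    _ = ∫⁻ ϑ, ENNReal.ofReal (truncPow q p K (phi β ϑ).ht)
          ∂(ν.prod (Measure.infinitePi fun _ : ℕ => η)) :=
        lintegral_map' (by fun_prop) (aemeasurable_phi_of_fixed hfix)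
    _ ≤ _ := lintegral_mono fun ϑ => ofReal_truncPow_ht_phi_le hq hqp hK hδ ϑ
    _ = _ := by
      rw [lintegral_add_left (by fun_prop), lintegral_const_mul _ (by fun_prop),
        lintegral_const_mul _ hsum]
      congr 2
      · rw [lintegral_prod _ (by fun_prop)]
        simp
      · rw [lintegral_prod _ hsum.aemeasurable]
        refine lintegral_congr fun ξ => ?_
        have hmi : ∀ i, AEMeasurable (fun t : ℕ → TreeSpace =>
            ENNReal.ofReal (truncPow q p K (ξ.mass i ^ β * (t i).ht)))
            (Measure.infinitePi fun _ : ℕ => η) := fun i =>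
          ((hm i).comp (measurable_prodMk_left (x := ξ))).aemeasurable
        rw [lintegral_tsum hmi]
        refine tsum_congr fun i => ?_
        exact (measurePreserving_eval_infinitePi (fun _ : ℕ => η) i).lintegral_comp
          (f := fun τ => ENNReal.ofReal (truncPow q p K (ξ.mass i ^ β * τ.ht))) (by fun_prop)

/-! ### Bootstrapping from the `q`-th to the `p`-th moment. -/

/-- The hypothesis is used at level `K / a`; since `a ^ p * (K / a) ^ (p - q) = a ^ q * K ^ (p -
q)`, the error term scales with exponent `q`. -/
theorem lintegral_truncPow_mul_le {q p : ℝ} (hq : 0 < q) {η : Measure TreeSpace} {A B : ℝ≥0∞}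
    (hAB : ∀ K, 0 < K → truncMoment q p K η ≤ A + B * ENNReal.ofReal (K ^ (p - q)))
    {K a : ℝ} (hK : 0 < K) (ha : 0 ≤ a) :
    ∫⁻ τ, ENNReal.ofReal (truncPow q p K (a * τ.ht)) ∂η ≤
      ENNReal.ofReal (a ^ p) * A +
        ENNReal.ofReal (a ^ q) * (B * ENNReal.ofReal (K ^ (p - q))) := by
  rcases ha.eq_or_lt with rfl | ha
  · simp [truncPow, Real.zero_rpow hq.ne']
  · calc ∫⁻ τ, ENNReal.ofReal (truncPow q p K (a * τ.ht)) ∂η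
        = ENNReal.ofReal (a ^ p) * truncMoment q p (K / a) η := by
          rw [truncMoment, ← lintegral_const_mul _ (by fun_prop)]
          refine lintegral_congr fun τ => ?_
          rw [truncPow_mul ha hK.le τ.ht_nonneg, ENNReal.ofReal_mul (by positivity)]
      _ ≤ ENNReal.ofReal (a ^ p) * (A + B * ENNReal.ofReal ((K / a) ^ (p - q))) := by
          gcongr
          exact hAB _ (div_pos hK ha)
      _ = _ := by
          have h : ENNReal.ofReal (a ^ q) * ENNReal.ofReal (K ^ (p - q)) =
              ENNReal.ofReal (a ^ p) * ENNReal.ofReal ((K / a) ^ (p - q)) := by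
            rw [← ENNReal.ofReal_mul (by positivity), ← ENNReal.ofReal_mul (by positivity),
              Real.div_rpow hK.le ha.le]
            congr 1
            rw [show a ^ p = a ^ q * a ^ (p - q) by
              rw [← Real.rpow_add ha]; congr 1; ring]
            have := Real.rpow_pos_of_pos ha (p - q)
            field_simp
          rw [mul_add, mul_left_comm _ B, ← h, mul_left_comm _ B]

theorem exists_pos_ofReal_rpow_mul_lt_one (p : ℝ) {c : ℝ≥0∞} (hc : c < 1) :
    ∃ δ : ℝ, 0 < δ ∧ ENNReal.ofReal ((1 + δ) ^ p) * c < 1 := by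
  have hcont : ContinuousAt (fun δ : ℝ => (1 + δ) ^ p) 0 :=
    ContinuousAt.rpow_const (by fun_prop) (Or.inl (by norm_num))
  have hlim : Filter.Tendsto (fun δ : ℝ => ENNReal.ofReal ((1 + δ) ^ p) * c) (nhds 0)
      (nhds c) := by
    have := ENNReal.Tendsto.mul_const (ENNReal.tendsto_ofReal hcont.tendsto) (b := c)
      (Or.inr (hc.trans ENNReal.one_lt_top).ne)
    simpa using this
  have h := (hlim.eventually_lt_const hc).filter_mono
    (nhdsWithin_le_nhds (s := Set.Ioi (0 : ℝ)))
  obtain ⟨δ, h1, h2⟩ := (h.and self_mem_nhdsWithin).exists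
  exact ⟨δ, h2, h1⟩

theorem exists_add_mul_le {C r : ℝ≥0∞} (hC : C < ∞) (hr : r < 1) :
    ∃ A : ℝ≥0∞, A < ∞ ∧ C + r * A ≤ A := by
  have h0 : 1 - r ≠ 0 := (tsub_pos_of_lt hr).ne'
  have ht : 1 - r ≠ ∞ := (tsub_le_self.trans_lt ENNReal.one_lt_top).ne
  refine ⟨(1 - r)⁻¹ * C, ENNReal.mul_lt_top (ENNReal.inv_lt_top.2 (pos_iff_ne_zero.2 h0)) hC,
    le_of_eq ?_⟩
  calc C + r * ((1 - r)⁻¹ * C) = (1 - r) * ((1 - r)⁻¹ * C) + r * ((1 - r)⁻¹ * C) := by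
        rw [← mul_assoc (1 - r), ENNReal.mul_inv_cancel h0 ht, one_mul]
    _ = _ := by rw [← add_mul, tsub_add_cancel_of_le hr.le, one_mul]

/-- Fatou's lemma: at each tree the truncation is inactive once `K` exceeds the height. -/
theorem heightMoment_le_of_truncMoment_le {q p : ℝ} (hp : p ≠ 0) {η : Measure TreeSpace}
    {A : ℝ≥0∞} (h : ∀ K, 0 < K → truncMoment q p K η ≤ A) : heightMoment p η ≤ A := by
  have hle : heightMoment p η ≤
      ∫⁻ τ, Filter.liminf (fun n : ℕ => ENNReal.ofReal (truncPow q p n τ.ht)) Filter.atTop ∂η := by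
    refine lintegral_mono fun τ => ?_
    obtain ⟨N, hN⟩ := exists_nat_ge τ.ht
    refine Filter.le_liminf_of_le (by isBoundedDefault) ?_
    filter_upwards [Filter.eventually_ge_atTop N] with n hn
    rw [truncPow_of_le hp τ.ht_nonneg (hN.trans (by exact_mod_cast hn))]
  refine (hle.trans (lintegral_liminf_le fun n => by fun_prop)).trans ?_
  refine Filter.liminf_le_of_frequently_le' (Filter.Eventually.frequently ?_)
  filter_upwards [Filter.eventually_gt_atTop 0] with n hn
  exact h n (by exact_mod_cast hn)

theorem heightMoment_lt_top_of_fixed {β q p : ℝ} {ν : Measure BeadString}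
    [IsProbabilityMeasure ν] {η : Measure TreeSpace} [IsProbabilityMeasure η]
    (hfix : Phi β ν η = η) (hq : Admissible β ν q) (hp : Admissible β ν p) (hqp : q ≤ p)
    (hη : heightMoment q η < ∞) : heightMoment p η < ∞ := by
  have hq0 : 0 < q := one_pos.trans_le hq.1
  have hp0 : p ≠ 0 := (hq0.trans_le hqp).ne'
  set c : ℝ → ℝ≥0∞ := fun s => ∫⁻ ξ, ∑' i, ENNReal.ofReal (ξ.mass i ^ (s * β)) ∂ν with hc
  -- One `δ` serves both exponents: `p` for the existence of `A`, `q` for the decay of the error.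
  obtain ⟨δ, hδ, hcδ⟩ := exists_pos_ofReal_rpow_mul_lt_one p (max_lt hq.2.2 hp.2.2)
  set D : ℝ≥0∞ := ENNReal.ofReal ((1 + δ) ^ p) with hD
  have hDq : D * c q < 1 := (mul_le_mul_right (le_max_left _ _) D).trans_lt hcδ
  have hDp : D * c p < 1 := (mul_le_mul_right (le_max_right _ _) D).trans_lt hcδ
  set C : ℝ≥0∞ := ENNReal.ofReal ((1 + δ⁻¹) ^ p) * ∫⁻ ξ, ENNReal.ofReal (ξ.len ^ p) ∂ν with hCdef
  obtain ⟨A, hA, hCA⟩ := exists_add_mul_le (C := C)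
    (ENNReal.mul_lt_top ENNReal.ofReal_lt_top hp.2.1) hDp
  have hstep : ∀ n : ℕ, ∀ K, 0 < K → truncMoment q p K η ≤
      A + ((D * c q) ^ n * heightMoment q η) * ENNReal.ofReal (K ^ (p - q)) := by
    intro n
    induction n with
    | zero =>
      intro K hK
      rw [pow_zero, one_mul, heightMoment, ← lintegral_mul_const _ (by fun_prop)]
      refine le_add_left (lintegral_mono fun τ => ?_)
      have := τ.ht_nonneg
      rw [← ENNReal.ofReal_mul (by positivity)]
      exact ENNReal.ofReal_le_ofReal (truncPow_le_mul_rpow hqp hK.le this)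
    | succ n ih =>
      intro K hK
      set B : ℝ≥0∞ := (D * c q) ^ n * heightMoment q η
      set κ : ℝ≥0∞ := ENNReal.ofReal (K ^ (p - q))
      have hint : ∫⁻ ξ, ∑' i,
            ∫⁻ τ, ENNReal.ofReal (truncPow q p K (ξ.mass i ^ β * τ.ht)) ∂η ∂ν ≤
          c p * A + c q * (B * κ) := by
        calc _ ≤ ∫⁻ ξ, ∑' i, (ENNReal.ofReal (ξ.mass i ^ (p * β)) * A +
                ENNReal.ofReal (ξ.mass i ^ (q * β)) * (B * κ)) ∂ν := by
              refine lintegral_mono fun ξ => ENNReal.tsum_le_tsum fun i => ?_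
              have hm := ξ.mass_nonneg i
              have := lintegral_truncPow_mul_le hq0 ih hK (Real.rpow_nonneg hm β)
              rwa [← Real.rpow_mul hm, ← Real.rpow_mul hm, mul_comm β p, mul_comm β q] at this
          _ = _ := by
              simp_rw [ENNReal.tsum_add, ENNReal.tsum_mul_right]
              have hm : ∀ s : ℝ, Measurable fun ξ : BeadString =>
                  ∑' i, ENNReal.ofReal (ξ.mass i ^ (s * β)) :=
                fun s => Measurable.tsum fun i => by fun_prop
              rw [lintegral_add_left ((hm p).mul_const _), lintegral_mul_const _ (hm p),
                lintegral_mul_const _ (hm q)]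
      calc truncMoment q p K η ≤ C + D * (c p * A + c q * (B * κ)) :=
            (truncMoment_le_of_fixed hfix hq0 hqp hK.le hδ).trans (by gcongr)
        _ = (C + D * c p * A) + (D * c q) * B * κ := by ring
        _ ≤ A + (D * c q) * B * κ := by gcongr
        _ = _ := by rw [pow_succ']; simp only [B]; ring
  refine (heightMoment_le_of_truncMoment_le (q := q) hp0 fun K hK => ?_).trans_lt hA
  -- With `K` fixed the error vanishes as `n → ∞`, because the `q`-th moment is finite.
  refine ge_of_tendsto' (x := Filter.atTop) ?_ fun n => hstep n K hK
  have h1 := ENNReal.tendsto_pow_atTop_nhds_zero_of_lt_one hDq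
  have h2 := ENNReal.Tendsto.mul_const h1 (b := heightMoment q η) (Or.inr hη.ne)
  have h3 := ENNReal.Tendsto.mul_const h2 (b := ENNReal.ofReal (K ^ (p - q)))
    (Or.inr ENNReal.ofReal_ne_top)
  simpa using h3.const_add A

/-- Uses `h ^ p ≤ 1 + h ^ q` and finiteness of the total mass. -/
theorem heightMoment_lt_top_of_le {p q : ℝ} (hp : 0 ≤ p) (hpq : p ≤ q) {η : Measure TreeSpace}
    [IsProbabilityMeasure η] (hη : heightMoment q η < ∞) : heightMoment p η < ∞ := by
  calc heightMoment p η ≤ ∫⁻ τ, (1 + ENNReal.ofReal (τ.ht ^ q)) ∂η := by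
        refine lintegral_mono fun τ => ?_
        have h0 := τ.ht_nonneg
        rw [← ENNReal.ofReal_one, ← ENNReal.ofReal_add zero_le_one (by positivity)]
        refine ENNReal.ofReal_le_ofReal ?_
        rcases le_total τ.ht 1 with h | h
        · exact (Real.rpow_le_one h0 h hp).trans (le_add_of_nonneg_right (by positivity))
        · exact (Real.rpow_le_rpow_of_exponent_le h hpq).trans
            (le_add_of_nonneg_left zero_le_one)
    _ = 1 + heightMoment q η := by
        rw [lintegral_add_left measurable_const]; simp [heightMoment]
    _ < ∞ := ENNReal.add_lt_top.2 ⟨ENNReal.one_lt_top, hη⟩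

end CRT

theorem mainTheorem10
    (β : ℝ) (hβ : 0 < β)
    (ν : Measure CRT.BeadString) [IsProbabilityMeasure ν]
    (p₀ : ℝ) (hp₀ : CRT.Admissible β ν p₀)
    (η : Measure CRT.TreeSpace) (hη : η ∈ CRT.Pspace p₀) (hfix : CRT.Phi β ν η = η)
    {Ω : Type*} [MeasurableSpace Ω] (P : Measure Ω) [IsProbabilityMeasure P]
    (T : Ω → CRT.TreeSpace) (hT : HasLaw T η P) :
    (∀ p : ℝ, CRT.Admissible β ν p → η ∈ CRT.Pspace p) ∧
    ∀ p : ℝ, 0 ≤ p → (p : EReal) < CRT.pStar β ν →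
      ∫⁻ ω, ENNReal.ofReal ((T ω).ht ^ p) ∂P < ∞ := by
  obtain ⟨_, hmom⟩ := hη
  have hadm : ∀ p : ℝ, CRT.Admissible β ν p → CRT.heightMoment p η < ∞ := fun p hp =>
    (le_total p p₀).elim
      (fun h => CRT.heightMoment_lt_top_of_le (zero_le_one.trans hp.1) h hmom)
      (fun h => CRT.heightMoment_lt_top_of_fixed hfix hp₀ hp h hmom)
  refine ⟨fun p hp => ⟨‹_›, hadm p hp⟩, fun p hp hlt => ?_⟩
  -- Some admissible `q` lies above `p`; `p` itself need not be admissible.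
  obtain ⟨-, ⟨q, hq, rfl⟩, hpq⟩ := lt_sSup_iff.1 hlt
  have h := CRT.heightMoment_lt_top_of_le hp (EReal.coe_lt_coe_iff.1 hpq).le (hadm q hq)
  rw [CRT.heightMoment, ← hT.map_eq, lintegral_map' (by fun_prop) hT.aemeasurable] at h
  exact h
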